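/- Let $X$ be a (real or complex) Fréchet space, i.e. a complete Hausdorff locally convex space whose topology is generated by a sequence of seminorms $p_n$, $n\in\mathbb N$. A signed (finite) Borel measure $\mu$ on a Hausdorff space is called Radon if for every Borel set $B$ and every $\varepsilon>0$ there is a compact set $K\subset B$ with $|\mu|(B\setminus K)<\varepsilon$, where $|\mu|=\mu^++\mu^-$ is the total variation. Let $\mathcal M$ be a uniformly tight family of signed Radon measures on $X$, i.e. for every $\varepsilon>0$ there is a compact set $K\subset X$ such that $|\mu|(X\setminus K)<\varepsilon$ for all $\mu\in\mathcal M$. Suppose that every $p_n$ is uniformly integrable with respect to $\mathcal M$, i.e. $$\lim_{m\to\infty}\ \sup_{\mu\in\mathcal M}\int_{\{x:\,p_n(x)>m\}}p_n(x)\,|\mu|(dx)=0\qquad\text{for every } n.$$ Then there is a linear subspace $E\subset X$ with a norm $\|\cdot\|_E$ such that: (i) $(E,\|\cdot\|_E)$ is a separable reflexive Banach space whose closed unit ball is compact in $X$; (ii) the Borel $\sigma$-algebra of $(E,\|\cdot\|_E)$ consists exactly of the sets $B\cap E$ with $B$ Borel in $X$, and $E$ and all Borel sets of $(E,\|\cdot\|_E)$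 are Borel in $X$; every $\mu\in\mathcal M$ is concentrated on $E$, i.e. $|\mu|(X\setminus E)=0$; the restrictions of the measures $\mu\in\mathcal M$ to the Borel $\sigma$-algebra of $(E,\|\cdot\|_E)$ are Radon measures on $(E,\|\cdot\|_E)$ and form a uniformly tight family there (with compact sets of $(E,\|\cdot\|_E)$); and the norm is uniformly integrable: $$\lim_{m\to\infty}\ \sup_{\mu\in\mathcal M}\int_{\{x\in E:\,\|x\|_E>m\}}\|x\|_E\,|\mu|(dx)=0 .$$ -/

import Mathlib

open MeasureTheory Filter Topology

noncomputable section

/-! ### Families of Radon measures -/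

section Measures

variable {X : Type*} [MeasurableSpace X]

/-- A signed Borel measure `μ` is Radon if for every Borel set `B` and every `ε > 0` there is a
compact set `K ⊆ B` with `|μ|(B \ K) < ε`. -/
def IsRadonSigned [TopologicalSpace X] (μ : SignedMeasure X) : Prop :=
  ∀ B : Set X, MeasurableSet B → ∀ ε : ENNReal, 0 < ε →
    ∃ K : Set X, IsCompact K ∧ K ⊆ B ∧ μ.totalVariation (B \ K) < ε

/-- A set `M` of signed measures is uniformly tight if for every `ε > 0` there is a compact set `K`
with `|μ|(X \ K) < ε` for all `μ ∈ M`. -/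
def UniformlyTight [TopologicalSpace X] (M : Set (SignedMeasure X)) : Prop :=
  ∀ ε : ENNReal, 0 < ε → ∃ K : Set X, IsCompact K ∧ ∀ μ ∈ M, μ.totalVariation Kᶜ < ε

/-- A (nonnegative measurable) function `p` is uniformly integrable with respect to the measures
in `M`: the integrals of `p` over `{p > m}` against `|μ|` tend to zero as `m → ∞`, uniformly in
`μ ∈ M`. -/
def UniformlyIntegrableOver (M : Set (SignedMeasure X)) (p : X → ℝ) : Prop :=
  Tendsto (fun m : ℝ => ⨆ μ ∈ M, ∫⁻ x in {x | m < p x}, ENNReal.ofReal (p x) ∂μ.totalVariation)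
    atTop (𝓝 0)

/-- For a measurable embedding `f : Y → X`, the signed measure `B ↦ μ (f '' B)` on `Y`; if `f` is
the inclusion of a subspace, this is the restriction of `μ` to the subspace. -/
def restrictAlong {Y : Type*} [MeasurableSpace Y] {f : Y → X} (hf : MeasurableEmbedding f)
    (μ : SignedMeasure X) : SignedMeasure Y where
  measureOf' B := μ (f '' B)
  empty' := by simp
  not_measurable' B hB := μ.not_measurable fun h => hB (hf.measurableSet_image.1 h)
  m_iUnion' B hB hd := by
    rw [Set.image_iUnion]
    exact μ.m_iUnion (fun i => hf.measurableSet_image.2 (hB i)) fun i j hij =>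
      (Set.disjoint_image_iff hf.injective).2 (hd hij)

end Measures

/-! ### Linear subspaces with a norm of their own -/

/-- A linear subspace of `X` together with a norm on it, which need not be related to the topology
of `X`. -/
structure NormedSubspace (𝕜 : Type*) [RCLike 𝕜] (X : Type*) [AddCommGroup X] [Module 𝕜 X] where
  /-- the linear subspace -/
  carrier : Submodule 𝕜 X
  /-- the norm on it -/
  norm : Seminorm 𝕜 carrier
  eq_zero_of_norm : ∀ x, norm x = 0 → x = 0

namespace NormedSubspace

variable {𝕜 : Type*} [RCLike 𝕜] {X : Type*} [AddCommGroup X] [Module 𝕜 X]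

/-- The subspace as a type of its own, carrying its own norm, the norm topology and the Borel
σ-algebra of the norm topology (not the structures induced by `X`). -/
def Space (E : NormedSubspace 𝕜 X) : Type _ := E.carrier

variable (E : NormedSubspace 𝕜 X)

instance : AddCommGroup E.Space := inferInstanceAs (AddCommGroup E.carrier)

instance : Module 𝕜 E.Space := inferInstanceAs (Module 𝕜 E.carrier)

instance : NormedAddCommGroup E.Space :=
  AddGroupNorm.toNormedAddCommGroup (E := E.Space)
    { toFun := fun x => E.norm x
      map_zero' := map_zero E.norm
      add_le' := map_add_le_add E.norm
      neg' := map_neg_eq_map E.norm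
      eq_zero_of_map_eq_zero' := E.eq_zero_of_norm }

instance : NormedSpace 𝕜 E.Space where
  norm_smul_le c x := (map_smul_eq_mul E.norm c x).le

instance : MeasurableSpace E.Space := borel E.Space

instance : BorelSpace E.Space := ⟨rfl⟩

/-- The inclusion of the subspace into `X`. -/
def incl : E.Space →ₗ[𝕜] X := E.carrier.subtype

end NormedSubspace

/-- A normed space is reflexive if the canonical map into its bidual is onto. -/
def IsReflexiveSpace (𝕜 : Type*) [RCLike 𝕜] (F : Type*) [NormedAddCommGroup F]
    [NormedSpace 𝕜 F] : Prop :=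
  Function.Surjective (NormedSpace.inclusionInDoubleDual 𝕜 F)

end

/-!
Let `P j` be an increasing sequence of generating seminorms. By uniform tightness and uniform
integrability there are increasing compact sets `K j` outside which the integrals of
`2 ^ (j + 1) * (1 + P (j + 1))` against all `|μ|` are at most `δ j`, with `∑ j, δ j < ∞`. The points
of the `K j`, each divided by its weight `2 ^ j * (1 + P j x)`, form a totally bounded set, and
through successive finite nets such a set lies in the image of a compact subset of a Hilbert sum of
finite-dimensional `ℓ¹`-spaces under an operator `T` given by a rapidly convergent series. The space
`E` is the range of `T` with the quotient norm.

The unit ball of a Hilbert sum of finite-dimensional spaces is compact for coordinatewise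
convergence, and both `T` and all continuous functionals are continuous on it, being small on tails.
So the unit ball of `E` is compact in `X`, and by Hahn–Banach in the bidual `E` is reflexive. On
`K j` the norm of `E` is at most a constant times the weight. Summing over the shells
`K (j + 1) \ K j` bounds the integrals of `1 + ‖x‖` outside `K j`, which is both tightness on `E`
and uniform integrability of the norm.
-/

section Reflexivity

theorem exists_forall_mem_re_lt_of_isClosed_weakBilin {𝕜 V W : Type*} [RCLike 𝕜]
    [AddCommGroup V] [Module 𝕜 V] [Module ℝ V] [IsScalarTower ℝ 𝕜 V] [AddCommGroup W] [Module 𝕜 W]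
    {B : V →ₗ[𝕜] W →ₗ[𝕜] 𝕜} {A : Set (WeakBilin B)} (hconvex : Convex ℝ A) (hclosed : IsClosed A)
    {v : V} (hv : v ∉ A) :
    ∃ (w : W) (u : ℝ), (∀ a ∈ A, RCLike.re (B a w) < u) ∧ u < RCLike.re (B v w) := by
  obtain ⟨f, u, hu, hlt⟩ := RCLike.geometric_hahn_banach_closed_point (𝕜 := 𝕜) hconvex hclosed hv
  obtain ⟨w, rfl⟩ := B.dualEmbedding_surjective f
  exact ⟨w, u, hu, hlt⟩

variable {𝕜 F : Type*} [RCLike 𝕜] [NormedAddCommGroup F] [NormedSpace 𝕜 F]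

theorem opNorm_le_of_forall_re_le {φ : StrongDual 𝕜 F} {u : ℝ}
    (hu : ∀ x : F, ‖x‖ ≤ 1 → RCLike.re (φ x) ≤ u) : ‖φ‖ ≤ u := by
  refine φ.opNorm_le_of_unit_norm (by simpa using hu 0 (by simp)) fun x hx => ?_
  obtain ⟨c, hc, hcx⟩ := RCLike.exists_norm_eq_mul_self (φ x)
  have hre : RCLike.re (φ (c • x)) = ‖φ x‖ := by
    rw [map_smul, smul_eq_mul, ← hcx, RCLike.ofReal_re]
  exact hre ▸ hu (c • x) (by rw [norm_smul, hc, hx, one_mul])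

theorem isReflexiveSpace_of_forall_norm_le_one
    (h : ∀ ξ : StrongDual 𝕜 (StrongDual 𝕜 F), ‖ξ‖ ≤ 1 →
      ∃ x, NormedSpace.inclusionInDoubleDual 𝕜 F x = ξ) : IsReflexiveSpace 𝕜 F := by
  intro ξ
  obtain ⟨c, hc⟩ := NormedField.exists_lt_norm 𝕜 ‖ξ‖
  have hc0 : 0 < ‖c‖ := (norm_nonneg ξ).trans_lt hc
  obtain ⟨x, hx⟩ := h (c⁻¹ • ξ) <| by
    refine (ContinuousLinearMap.opNorm_smul_le _ _).trans ?_
    rw [norm_inv, inv_mul_le_iff₀ hc0, mul_one]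
    exact hc.le
  exact ⟨c • x, by rw [map_smul, hx, smul_inv_smul₀ (norm_pos_iff.1 hc0)]⟩

theorem exists_forall_apply_eq_of_compact_parametrization {S : Type*} [TopologicalSpace S]
    [CompactSpace S] (g : S → F) (hg : Set.range g = Metric.closedBall 0 1)
    (hcont : ∀ φ : StrongDual 𝕜 F, Continuous fun s => φ (g s))
    (ξ : Module.Dual 𝕜 (StrongDual 𝕜 F)) (hξ : ∀ φ, ‖ξ φ‖ ≤ ‖φ‖) :
    ∃ x : F, ∀ φ : StrongDual 𝕜 F, φ x = ξ φ := by
  let : NormedSpace ℝ F := NormedSpace.restrictScalars ℝ 𝕜 F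
  have : IsScalarTower ℝ 𝕜 F := RestrictScalars.isScalarTower ℝ 𝕜 F
  let B : Module.Dual 𝕜 (StrongDual 𝕜 F) →ₗ[𝕜] StrongDual 𝕜 F →ₗ[𝕜] 𝕜 := LinearMap.id
  let J : F →ₗ[𝕜] WeakBilin B := (topDualPairing 𝕜 F).flip
  have hclosed : IsClosed (J '' Metric.closedBall 0 1) := by
    have : T2Space (WeakBilin B) := (WeakBilin.isEmbedding (B := B) Function.injective_id).t2Space
    rw [← hg, ← Set.range_comp]
    exact (isCompact_range (WeakBilin.continuous_of_continuous_eval B hcont)).isClosed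
  have hconvex : Convex ℝ (J '' Metric.closedBall 0 1) :=
    (convex_closedBall (0 : F) 1).linear_image (J.restrictScalars ℝ)
  by_contra! hnot
  obtain ⟨φ, u, hu, hlt⟩ := exists_forall_mem_re_lt_of_isClosed_weakBilin (v := ξ) hconvex hclosed
    (by
      rintro ⟨x, -, rfl⟩
      obtain ⟨φ, hφ⟩ := hnot x
      exact hφ rfl)
  have hφ : ‖φ‖ ≤ u := opNorm_le_of_forall_re_le fun x hx =>
    (hu (J x) ⟨x, mem_closedBall_zero_iff.2 hx, rfl⟩).le
  exact (((RCLike.re_le_norm _).trans (hξ φ)).trans hφ).not_gt hlt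

theorem isReflexiveSpace_of_compact_parametrization {S : Type*} [TopologicalSpace S]
    [CompactSpace S] (g : S → F) (hg : Set.range g = Metric.closedBall 0 1)
    (hcont : ∀ φ : StrongDual 𝕜 F, Continuous fun s => φ (g s)) : IsReflexiveSpace 𝕜 F := by
  refine isReflexiveSpace_of_forall_norm_le_one fun ξ hξ => ?_
  obtain ⟨x, hx⟩ := exists_forall_apply_eq_of_compact_parametrization g hg hcont ξ.toLinearMap
    fun φ => (ξ.le_of_opNorm_le hξ φ).trans_eq (one_mul _)
  exact ⟨x, ContinuousLinearMap.ext hx⟩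

end Reflexivity

section LpUnitBall

open scoped ENNReal

variable {ι : Type*} {Y : ι → Type*} [∀ i, NormedAddCommGroup (Y i)] {r : ℝ≥0∞}

theorem sum_single_apply [DecidableEq ι] (z : lp Y r) (s : Finset ι) (i : ι) :
    (∑ j ∈ s, lp.single r j (z j) : lp Y r) i = if i ∈ s then z i else 0 := by
  rw [lp.coeFn_sum, Finset.sum_apply]
  split_ifs with hi
  · rw [Finset.sum_eq_single_of_mem i hi fun j _ hji => lp.single_apply_ne r j _ hji.symm,
      lp.single_apply_self]
  · exact Finset.sum_eq_zero fun j hj => lp.single_apply_ne r j _ fun h => hi (h ▸ hj)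

variable [Fact (1 ≤ r)]

theorem separableSpace_lp [Countable ι] [∀ i, TopologicalSpace.SeparableSpace (Y i)] (hr : r ≠ ∞) :
    TopologicalSpace.SeparableSpace (lp Y r) := by
  classical
  let D : Set (lp Y r) := ⋃ i, Set.range (lp.single r i)
  have hD : TopologicalSpace.IsSeparable D := TopologicalSpace.IsSeparable.iUnion fun i =>
    TopologicalSpace.isSeparable_range (lp.isometry_single i).continuous
  rw [← TopologicalSpace.isSeparable_univ_iff]
  refine (hD.span (R := ℤ)).closure.mono fun z _ => ?_
  refine mem_closure_of_tendsto (lp.hasSum_single hr z) (univ_mem' fun s => ?_)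
  exact sum_mem fun i _ => Submodule.subset_span (Set.mem_iUnion.2 ⟨i, Set.mem_range_self _⟩)

theorem memℓp_of_summable_of_norm_le {c : ι → ℝ} (hc : Summable c) {z : ∀ i, Y i}
    (hz : ∀ i, ‖z i‖ ≤ c i) : Memℓp z r :=
  (memℓp_gen (p := 1) <| by
    simpa using Summable.of_nonneg_of_le (fun i => norm_nonneg (z i)) hz hc).of_exponent_ge Fact.out

theorem isCompact_setOf_norm_apply_le [∀ i, ProperSpace (Y i)] (hr : r ≠ ∞) {c : ι → ℝ}
    (hc : Summable c) : IsCompact {z : lp Y r | ∀ i, ‖z i‖ ≤ c i} := by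
  classical
  let S : Set (∀ i, Y i) := Set.univ.pi fun i => Metric.closedBall 0 (c i)
  have hS : IsCompact S := isCompact_univ_pi fun i => isCompact_closedBall 0 (c i)
  have hmem {z : ∀ i, Y i} : z ∈ S ↔ ∀ i, ‖z i‖ ≤ c i := by
    simp only [S, Set.mem_univ_pi, mem_closedBall_zero_iff]
  have hcont : ContinuousOn (fun z : ∀ i, Y i => ∑' i, lp.single r i (z i)) S :=
    continuousOn_tsum (fun i => ((lp.isometry_single i).continuous.comp
      (continuous_apply i)).continuousOn) hc fun i z hz => by
        rw [lp.norm_single (zero_lt_one.trans_le Fact.out)]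
        exact hmem.1 hz i
  convert! hS.image_of_continuousOn hcont using 1
  ext z
  refine ⟨fun hz => ⟨z, hmem.2 hz, (lp.hasSum_single hr z).tsum_eq⟩, ?_⟩
  rintro ⟨z, hz, rfl⟩
  have hz' := hmem.1 hz
  let w : lp Y r := ⟨z, memℓp_of_summable_of_norm_le hc hz'⟩
  change ∑' i, lp.single r i (w i) ∈ _
  rwa [(lp.hasSum_single hr w).tsum_eq]

variable (Y r) in
/-- The closed unit ball of the `ℓ^r`-sum of the spaces `Y i`. It is a type of its own because it
carries the topology of coordinatewise convergence, not the one of the norm. -/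
def LpUnitBall : Type _ := Metric.closedBall (0 : lp Y r) 1

namespace LpUnitBall

/-- The underlying point of the `ℓ^r`-sum. -/
def toLp (z : LpUnitBall Y r) : lp Y r := z.1

theorem norm_toLp_le (z : LpUnitBall Y r) : ‖z.toLp‖ ≤ 1 := mem_closedBall_zero_iff.1 z.2

theorem range_toLp : Set.range (toLp : LpUnitBall Y r → lp Y r) = Metric.closedBall 0 1 :=
  Subtype.range_coe

instance : TopologicalSpace (LpUnitBall Y r) :=
  TopologicalSpace.induced (fun z => (z.toLp : ∀ i, Y i)) inferInstance

theorem continuous_toLp_apply (i : ι) : Continuous fun z : LpUnitBall Y r => z.toLp i :=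
  (continuous_apply i).comp continuous_induced_dom

instance [∀ i, ProperSpace (Y i)] : CompactSpace (LpUnitBall Y r) where
  isCompact_univ := isCompact_iff_ultrafilter_le_nhds.2 fun u _ => by
    have hr : r ≠ 0 := (zero_lt_one.trans_le Fact.out).ne'
    have hlim (i : ι) : ∃ y, Tendsto (fun z : LpUnitBall Y r => z.toLp i) u (𝓝 y) := by
      have hball (z : LpUnitBall Y r) : z.toLp i ∈ Metric.closedBall 0 1 :=
        mem_closedBall_zero_iff.2 ((lp.norm_apply_le_norm hr _ i).trans z.norm_toLp_le)
      obtain ⟨y, -, hy⟩ := (isCompact_closedBall (0 : Y i) 1).ultrafilter_le_nhds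
        (u.map fun z : LpUnitBall Y r => z.toLp i)
        (le_principal_iff.2 <| mem_map.2 <| univ_mem' hball)
      exact ⟨y, hy⟩
    choose y hy using hlim
    have hy' : Tendsto (fun z : LpUnitBall Y r => (z.toLp : ∀ i, Y i)) u (𝓝 y) :=
      tendsto_pi_nhds.2 hy
    have hmem : Memℓp y r := lp.memℓp_of_tendsto
      (Metric.isBounded_closedBall.subset range_toLp.subset) hy'
    let y' : lp Y r := ⟨y, hmem⟩
    have hnorm : ‖y'‖ ≤ 1 := lp.norm_le_of_tendsto (univ_mem' norm_toLp_le) hy'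
    let z : LpUnitBall Y r := ⟨y', mem_closedBall_zero_iff.2 hnorm⟩
    exact ⟨z, Set.mem_univ z, (tendsto_iff_comap.1 hy').trans_eq (nhds_induced _ z).symm⟩

end LpUnitBall

variable {𝕜 X : Type*} [RCLike 𝕜] [∀ i, NormedSpace 𝕜 (Y i)] [AddCommGroup X] [Module 𝕜 X]

/-- A linear map on the `ℓ^r`-sum of the spaces `Y i` is small on tails if it is uniformly small on
the elements of the unit ball whose coordinates in a suitable finite set vanish. -/
def SmallOnTails [TopologicalSpace X] (T : lp Y r →ₗ[𝕜] X) : Prop :=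
  ∀ U ∈ 𝓝 (0 : X), ∃ s : Finset ι, ∀ w : lp Y r, ‖w‖ ≤ 1 → (∀ i ∈ s, w i = 0) → T w ∈ U

theorem SmallOnTails.continuous_comp_toLp [DecidableEq ι] [UniformSpace X] [IsUniformAddGroup X]
    {T : lp Y r →ₗ[𝕜] X} (hT : SmallOnTails T)
    (hcont : ∀ i, Continuous fun y => T (lp.single r i y)) :
    Continuous fun z : LpUnitBall Y r => T z.toLp := by
  refine continuous_of_uniform_approx_of_continuous fun u hu => ?_
  rw [uniformity_eq_comap_nhds_zero] at hu
  obtain ⟨U, hU, hUu⟩ := hu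
  obtain ⟨s, hs⟩ := hT (-U) (neg_mem_nhds_zero X hU)
  refine ⟨fun z => ∑ i ∈ s, T (lp.single r i (z.toLp i)), ?_, fun z => hUu ?_⟩
  · exact continuous_finsetSum _ fun i _ => (hcont i).comp (LpUnitBall.continuous_toLp_apply i)
  let w : lp Y r := z.toLp - ∑ i ∈ s, lp.single r i (z.toLp i)
  have hw (i : ι) : w i = if i ∈ s then 0 else z.toLp i := by
    rw [lp.coeFn_sub, Pi.sub_apply, sum_single_apply]
    split_ifs <;> simp
  have hnorm : ‖w‖ ≤ 1 := by
    refine (lp.norm_mono (zero_lt_one.trans_le Fact.out).ne' fun i => ?_).trans z.norm_toLp_le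
    rw [hw]
    split_ifs <;> simp
  have := hs w hnorm fun i hi => by rw [hw, if_pos hi]
  rwa [map_sub, map_sum, Set.mem_neg, neg_sub] at this

end LpUnitBall

section HilbertSum

variable {𝕜 ι : Type*} [RCLike 𝕜] {Y : ι → Type*} [∀ i, NormedAddCommGroup (Y i)]
  [∀ i, NormedSpace 𝕜 (Y i)]

theorem norm_sum_single_add_sq_le [DecidableEq ι] (z w : lp Y 2) (s : Finset ι)
    (hw : ∀ i ∈ s, w i = 0) :
    ‖∑ i ∈ s, lp.single 2 i (z i) + w‖ ^ 2 ≤ ‖z‖ ^ 2 + ‖w‖ ^ 2 := by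
  set f : lp Y 2 := ∑ i ∈ s, lp.single 2 i (z i) + w with hf
  have hfs (i : ι) (hi : i ∈ s) : f i = z i := by
    rw [hf, lp.coeFn_add, Pi.add_apply, sum_single_apply, if_pos hi, hw i hi, add_zero]
  have hfw : f - ∑ i ∈ s, lp.single 2 i (f i) = w := by
    rw [Finset.sum_congr rfl fun i hi => by rw [hfs i hi], hf, add_sub_cancel_left]
  have hsplit := lp.norm_compl_sum_single (by simp) f s
  have hz := lp.sum_rpow_le_norm_rpow (by simp) z s
  rw [hfw, Finset.sum_congr rfl fun i hi => by rw [hfs i hi]] at hsplit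
  simp only [ENNReal.toReal_ofNat, Real.rpow_ofNat] at hsplit hz
  linarith

theorem exists_norm_sub_lt_norm_sum_single [DecidableEq ι] (ψ : StrongDual 𝕜 (lp Y 2)) {δ : ℝ}
    (hδ : 0 < δ) : ∃ (z : lp Y 2) (s : Finset ι), ‖z‖ ≤ 1 ∧
      ‖ψ‖ - δ < ‖ψ (∑ i ∈ s, lp.single 2 i (z i))‖ := by
  obtain ⟨z, hz, hψz⟩ := ψ.exists_lt_apply_of_lt_opNorm (sub_lt_self ‖ψ‖ hδ)
  have hlim : Tendsto (fun s : Finset ι => ‖ψ (∑ i ∈ s, lp.single 2 i (z i))‖) atTop (𝓝 ‖ψ z‖) :=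
    (ψ.continuous.norm.tendsto z).comp (lp.hasSum_single (by simp) z)
  obtain ⟨s, hs⟩ := (hlim.eventually_const_lt hψz).exists
  exact ⟨z, s, hz.le, hs⟩

theorem exists_norm_apply_add_smul_eq {V : Type*} [AddCommGroup V] [Module 𝕜 V]
    (ψ : V →ₗ[𝕜] 𝕜) (u w : V) {t : ℝ} (ht : 0 ≤ t) :
    ∃ c : 𝕜, ‖c‖ = t ∧ ‖ψ (u + c • w)‖ = ‖ψ u‖ + t * ‖ψ w‖ := by
  obtain ⟨a, ha, hau⟩ := RCLike.exists_norm_mul_eq_self (ψ u)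
  obtain ⟨b, hb, hbw⟩ := RCLike.exists_norm_eq_mul_self (ψ w)
  refine ⟨a * t * b, by simp [ha, hb, ht], ?_⟩
  have h : ψ (u + (a * t * b) • w) = a * ((‖ψ u‖ + t * ‖ψ w‖ : ℝ) : 𝕜) := by
    rw [map_add, map_smul, smul_eq_mul]
    push_cast
    linear_combination (-1 : 𝕜) * hau - a * t * hbw
  rw [h, norm_mul, ha, one_mul, RCLike.norm_ofReal, abs_of_nonneg (by positivity)]

theorem smallOnTails_strongDual (ψ : StrongDual 𝕜 (lp Y 2)) : SmallOnTails ψ.toLinearMap := by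
  classical
  intro U hU
  obtain ⟨ε, hε, hεU⟩ := Metric.mem_nhds_iff.1 hU
  set t : ℝ := ε / (‖ψ‖ + 2)
  have ht0 : 0 < t := by positivity
  obtain ⟨z, s, hz, hψ⟩ := exists_norm_sub_lt_norm_sum_single ψ (pow_pos ht0 2)
  refine ⟨s, fun w hw hws => hεU (mem_ball_zero_iff.2 ?_)⟩
  set u : lp Y 2 := ∑ i ∈ s, lp.single 2 i (z i)
  -- Moving from the almost norming `u` by `t` in the direction of `w` changes the norm only to
  -- second order in `t`, so `ψ w` must be small.
  obtain ⟨c, hc, hψc⟩ := exists_norm_apply_add_smul_eq ψ.toLinearMap u w ht0.le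
  have hnorm : ‖u + c • w‖ ≤ 1 + t ^ 2 := by
    have hsq := norm_sum_single_add_sq_le z (c • w) s fun i hi => by simp [hws i hi]
    rw [norm_smul, hc] at hsq
    refine le_of_sq_le_sq ?_ (by positivity)
    nlinarith [norm_nonneg z, mul_le_of_le_one_right ht0.le hw, norm_nonneg w,
      mul_nonneg ht0.le (norm_nonneg w)]
  have hupper : ‖ψ u‖ + t * ‖ψ w‖ ≤ ‖ψ‖ * (1 + t ^ 2) := hψc ▸ ψ.le_opNorm_of_le hnorm
  have hlt : t * ‖ψ w‖ < t * ε := by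
    have : t * (‖ψ‖ + 2) = ε := div_mul_cancel₀ _ (by positivity)
    nlinarith
  exact lt_of_mul_lt_mul_left hlt ht0.le

end HilbertSum

section Range

variable {𝕜 F X : Type*} [RCLike 𝕜] [NormedAddCommGroup F] [NormedSpace 𝕜 F] [AddCommGroup X]
  [Module 𝕜 X]

namespace NormedSubspace

theorem incl_injective (E : NormedSubspace 𝕜 X) : Function.Injective E.incl :=
  Subtype.val_injective

theorem range_incl (E : NormedSubspace 𝕜 X) : Set.range E.incl = E.carrier :=
  Subtype.range_coe

/-- The range of `T`, normed as the quotient of the domain by the kernel: the norm of `x` is the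
infimum of the norms of its preimages. -/
noncomputable def range (T : F →ₗ[𝕜] X) (hT : IsClosed (LinearMap.ker T : Set F)) :
    NormedSubspace 𝕜 X where
  carrier := LinearMap.range T
  norm := (normSeminorm 𝕜 (F ⧸ LinearMap.ker T)).comp T.quotKerEquivRange.symm.toLinearMap
  eq_zero_of_norm _ hx :=
    haveI : IsClosed ((LinearMap.ker T).toAddSubgroup : Set F) := hT
    (map_eq_zero_iff _ T.quotKerEquivRange.symm.injective).1 (norm_eq_zero.1 hx)

variable (T : F →ₗ[𝕜] X) (hT : IsClosed (LinearMap.ker T : Set F))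

/-- The range of `T` is isometric to the quotient of the domain by the kernel. -/
noncomputable def rangeIsometry : (F ⧸ LinearMap.ker T) ≃ₗᵢ[𝕜] (range T hT).Space where
  toLinearEquiv := T.quotKerEquivRange
  norm_map' x := by
    change ‖T.quotKerEquivRange.symm (T.quotKerEquivRange x)‖ = ‖x‖
    rw [LinearEquiv.symm_apply_apply]

/-- The map `T` with its range, as a normed space, for codomain. -/
noncomputable def toRange : F →L[𝕜] (range T hT).Space :=
  (rangeIsometry T hT).toContinuousLinearEquiv.toContinuousLinearMap ∘L (LinearMap.ker T).mkQL

theorem incl_toRange (x : F) : (range T hT).incl (toRange T hT x) = T x :=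
  T.quotKerEquivRange_apply_mk x

theorem isQuotientMap_toRange : IsQuotientMap (toRange T hT) :=
  (rangeIsometry T hT).toHomeomorph.isQuotientMap.comp (LinearMap.ker T).isQuotientMap_mkQL

theorem continuous_incl_range [TopologicalSpace X] (hcont : Continuous T) :
    Continuous (range T hT).incl := by
  rw [(isQuotientMap_toRange T hT).continuous_iff]
  exact hcont.congr fun x => (incl_toRange T hT x).symm

theorem completeSpace_range [CompleteSpace F] : CompleteSpace (range T hT).Space :=
  (completeSpace_congr (e := (rangeIsometry T hT).toEquiv)
    (rangeIsometry T hT).isometry.isUniformEmbedding).1 inferInstance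

theorem separableSpace_range [TopologicalSpace.SeparableSpace F] :
    TopologicalSpace.SeparableSpace (range T hT).Space :=
  (isQuotientMap_toRange T hT).surjective.denseRange.separableSpace (toRange T hT).continuous

theorem norm_toRange_le (x : F) : ‖toRange T hT x‖ ≤ ‖x‖ :=
  ((rangeIsometry T hT).norm_map _).trans_le (Submodule.Quotient.norm_mk_le _ x)

theorem ball_subset_image_toRange :
    Metric.ball 0 1 ⊆ toRange T hT '' Metric.ball 0 1 := by
  intro y hy
  obtain ⟨q, rfl⟩ := (rangeIsometry T hT).surjective y
  rw [mem_ball_zero_iff, LinearIsometryEquiv.norm_map] at hy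
  obtain ⟨x, hxq, hx⟩ := QuotientAddGroup.norm_lt_iff.1 hy
  exact ⟨x, mem_ball_zero_iff.2 hx, congrArg (rangeIsometry T hT) hxq⟩

theorem image_toRange_closedBall [TopologicalSpace X] (hcont : Continuous T)
    (hclosed : IsClosed (T '' Metric.closedBall 0 1)) :
    toRange T hT '' Metric.closedBall 0 1 = Metric.closedBall 0 1 := by
  refine Set.Subset.antisymm (Set.image_subset_iff.2 fun x hx => ?_) ?_
  · exact mem_closedBall_zero_iff.2 ((norm_toRange_le T hT x).trans (mem_closedBall_zero_iff.1 hx))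
  have heq : toRange T hT '' Metric.closedBall 0 1 =
      (range T hT).incl ⁻¹' (T '' Metric.closedBall 0 1) := by
    rw [← (range T hT).incl_injective.preimage_image (toRange T hT '' _), Set.image_image]
    simp only [incl_toRange]
  let _ : NormedSpace ℝ (range T hT).Space := NormedSpace.restrictScalars ℝ 𝕜 _
  rw [← closure_ball (0 : (range T hT).Space) one_ne_zero]
  refine closure_minimal ?_ (heq ▸ hclosed.preimage (continuous_incl_range T hT hcont))
  exact (ball_subset_image_toRange T hT).trans (Set.image_mono Metric.ball_subset_closedBall)

end NormedSubspace

end Range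

section RangeOfHilbertSum

variable {𝕜 ι X : Type*} [RCLike 𝕜] {Y : ι → Type*} [∀ i, NormedAddCommGroup (Y i)]
  [∀ i, NormedSpace 𝕜 (Y i)] [AddCommGroup X] [Module 𝕜 X]

/-- The normed subspaces the theorem asks for: separable reflexive Banach spaces with unit ball
compact in the ambient space. -/
def NormedSubspace.IsSeparableReflexiveCompact [TopologicalSpace X] (E : NormedSubspace 𝕜 X) :
    Prop :=
  CompleteSpace E.Space ∧ TopologicalSpace.SeparableSpace E.Space ∧
    IsReflexiveSpace 𝕜 E.Space ∧ IsCompact (E.incl '' Metric.closedBall 0 1)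

theorem SmallOnTails.isCompact_image_closedBall {r : ENNReal} [Fact (1 ≤ r)] [UniformSpace X]
    [IsUniformAddGroup X] [∀ i, ProperSpace (Y i)] {T : lp Y r →ₗ[𝕜] X} (hT : SmallOnTails T)
    (hcont : Continuous T) : IsCompact (T '' Metric.closedBall 0 1) := by
  classical
  rw [← LpUnitBall.range_toLp, ← Set.range_comp]
  exact isCompact_range <| hT.continuous_comp_toLp fun i =>
    hcont.comp (lp.isometry_single i).continuous

theorem isReflexiveSpace_range [∀ i, ProperSpace (Y i)] [TopologicalSpace X] {T : lp Y 2 →ₗ[𝕜] X}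
    (hT : IsClosed (LinearMap.ker T : Set (lp Y 2))) (hcont : Continuous T)
    (hclosed : IsClosed (T '' Metric.closedBall 0 1)) :
    IsReflexiveSpace 𝕜 (NormedSubspace.range T hT).Space := by
  classical
  let π := NormedSubspace.toRange T hT
  refine isReflexiveSpace_of_compact_parametrization
    (fun z : LpUnitBall Y 2 => π z.toLp) ?_ fun φ => ?_
  · rw [← NormedSubspace.image_toRange_closedBall T hT hcont hclosed, ← LpUnitBall.range_toLp,
      ← Set.range_comp]
    rfl
  · exact (smallOnTails_strongDual (φ ∘L π)).continuous_comp_toLp fun i =>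
      (φ ∘L π).continuous.comp (lp.isometry_single i).continuous

theorem SmallOnTails.isSeparableReflexiveCompact_range [Countable ι] [∀ i, ProperSpace (Y i)]
    [UniformSpace X] [IsUniformAddGroup X] [T2Space X] {T : lp Y 2 →L[𝕜] X}
    (hT : SmallOnTails T.toLinearMap) :
    (NormedSubspace.range T.toLinearMap T.isClosed_ker).IsSeparableReflexiveCompact := by
  have hcompact := hT.isCompact_image_closedBall T.continuous
  have : TopologicalSpace.SeparableSpace (lp Y 2) := separableSpace_lp (by simp)
  refine ⟨NormedSubspace.completeSpace_range _ _, NormedSubspace.separableSpace_range _ _,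
    isReflexiveSpace_range _ T.continuous hcompact.isClosed, ?_⟩
  rw [← NormedSubspace.image_toRange_closedBall _ _ T.continuous hcompact.isClosed,
    Set.image_image]
  simpa only [NormedSubspace.incl_toRange] using hcompact

end RangeOfHilbertSum

section SummableSeries

open scoped NNReal ENNReal

variable {𝕜 X ι : Type*} [RCLike 𝕜] [AddCommGroup X] [Module 𝕜 X]

theorem seminorm_sum_le (q : Seminorm 𝕜 X) (s : Finset ι) (u : ι → X) :
    q (∑ i ∈ s, u i) ≤ ∑ i ∈ s, q (u i) :=
  Finset.le_sum_of_subadditive q (map_zero q).le (map_add_le_add q) s u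

theorem seminorm_tsum_le [TopologicalSpace X] {q : Seminorm 𝕜 X} (hq : Continuous q) {u : ι → X}
    (hu : Summable u) (hqu : Summable fun i => q (u i)) : q (∑' i, u i) ≤ ∑' i, q (u i) :=
  le_of_tendsto_of_tendsto' ((hq.tendsto _).comp hu.hasSum) hqu.hasSum fun s =>
    seminorm_sum_le q s u

variable {Y : ι → Type*} [∀ i, NormedAddCommGroup (Y i)] [∀ i, NormedSpace 𝕜 (Y i)]
  {κ : Type*} {P : SeminormFamily 𝕜 X κ}

/-- The maps `τ i` have summable norms with respect to each seminorm of the family `P`. -/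
def SummablyBounded (P : SeminormFamily 𝕜 X κ) (τ : ∀ i, Y i →ₗ[𝕜] X) : Prop :=
  ∀ k, ∃ c : ι → ℝ≥0, Summable c ∧ ∀ i y, P k (τ i y) ≤ c i * ‖y‖

variable {τ : ∀ i, Y i →ₗ[𝕜] X} {r : ℝ≥0∞} [Fact (1 ≤ r)]

theorem seminorm_apply_le_mul_norm {q : Seminorm 𝕜 X} {c : ι → ℝ≥0}
    (hq : ∀ i y, q (τ i y) ≤ c i * ‖y‖) (z : lp Y r) (i : ι) : q (τ i (z i)) ≤ c i * ‖z‖ :=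
  (hq i _).trans <| by
    gcongr
    exact lp.norm_apply_le_norm (zero_lt_one.trans_le Fact.out).ne' z i

theorem SummablyBounded.summable_seminorm (hτ : SummablyBounded P τ) (z : lp Y r) (k : κ) :
    Summable fun i => P k (τ i (z i)) := by
  obtain ⟨c, hc, hτc⟩ := hτ k
  exact .of_nonneg_of_le (fun i => apply_nonneg _ _) (seminorm_apply_le_mul_norm hτc z)
    ((NNReal.summable_coe.2 hc).mul_right _)

variable [SemilatticeSup κ] [Nonempty κ]

theorem exists_seminorm_ball_subset [TopologicalSpace X] (hP : WithSeminorms P)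
    (hmono : Monotone P) {U : Set X} (hU : U ∈ 𝓝 0) : ∃ k, ∃ r > 0, (P k).ball 0 r ⊆ U := by
  obtain ⟨⟨s, r⟩, hr, hU⟩ := hP.hasBasis_zero_ball.mem_iff.1 hU
  obtain ⟨k, hk⟩ := s.exists_le
  exact ⟨k, r, hr, (Seminorm.ball_antitone (Finset.sup_le fun i hi => hmono (hk i hi))).trans hU⟩

theorem summable_of_summable_seminorm [UniformSpace X] [IsUniformAddGroup X] [CompleteSpace X]
    (hP : WithSeminorms P) (hmono : Monotone P) {u : ι → X}
    (hu : ∀ k, Summable fun i => P k (u i)) : Summable u := by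
  refine summable_iff_vanishing.2 fun U hU => ?_
  obtain ⟨k, r, hr, hU⟩ := exists_seminorm_ball_subset hP hmono hU
  obtain ⟨s, hs⟩ := summable_iff_vanishing_norm.1 (hu k) r hr
  refine ⟨s, fun t ht => hU ((P k).mem_ball_zero.2 ?_)⟩
  exact (seminorm_sum_le (P k) t u).trans_lt ((le_abs_self _).trans_lt (hs t ht))

theorem SummablyBounded.exists_seminorm_tsum_le [UniformSpace X] [IsUniformAddGroup X]
    [CompleteSpace X] (hP : WithSeminorms P) (hmono : Monotone P) (hτ : SummablyBounded P τ)
    (k : κ) : ∃ c : ι → ℝ≥0, ∀ (z : lp Y r) (s : Finset ι), (∀ i ∈ s, z i = 0) →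
      P k (∑' i, τ i (z i)) ≤ (∑' i : {i // i ∉ s}, c i : ℝ≥0) * ‖z‖ := by
  obtain ⟨c, hc, hτc⟩ := hτ k
  refine ⟨c, fun z s hz => ?_⟩
  have hsummable := hτ.summable_seminorm z
  have hsupport : (Function.support fun i => P k (τ i (z i))) ⊆ {i | i ∉ s} := fun i hi his =>
    hi (by simp only [hz i his, map_zero])
  calc P k (∑' i, τ i (z i))
      ≤ ∑' i, P k (τ i (z i)) := seminorm_tsum_le (hP.continuous_seminorm k)
          (summable_of_summable_seminorm hP hmono hsummable) (hsummable k)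
    _ = ∑' i : {i // i ∉ s}, P k (τ i (z i)) := (tsum_subtype_eq_of_support_subset hsupport).symm
    _ ≤ ∑' i : {i // i ∉ s}, (c i : ℝ) * ‖z‖ :=
        ((hsummable k).subtype _).tsum_le_tsum (fun i => seminorm_apply_le_mul_norm hτc z i)
          (((NNReal.summable_coe.2 hc).mul_right _).subtype _)
    _ = (∑' i : {i // i ∉ s}, c i : ℝ≥0) * ‖z‖ := by rw [tsum_mul_right, NNReal.coe_tsum]

variable [UniformSpace X] [IsUniformAddGroup X] [CompleteSpace X] [T2Space X]

/-- The operator `z ↦ ∑ τ i (z i)` on the `ℓ^r`-sum of the spaces `Y i`. -/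
noncomputable def SummablyBounded.sumMap (hP : WithSeminorms P) (hmono : Monotone P)
    (hτ : SummablyBounded P τ) : lp Y r →L[𝕜] X :=
  haveI := hP.continuousSMul
  have hsummable (z : lp Y r) : Summable fun i => τ i (z i) :=
    summable_of_summable_seminorm hP hmono (hτ.summable_seminorm z)
  let T : lp Y r →ₗ[𝕜] X :=
    { toFun z := ∑' i, τ i (z i)
      map_add' z w := by
        simp only [lp.coeFn_add, Pi.add_apply, map_add]
        exact (hsummable z).tsum_add (hsummable w)
      map_smul' a z := by
        simp only [lp.coeFn_smul, Pi.smul_apply, map_smul, RingHom.id_apply]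
        exact (hsummable z).tsum_const_smul a }
  { T with
    cont := hP.continuous_normedSpace_dom _ T fun k =>
      have ⟨_, hc⟩ := hτ.exists_seminorm_tsum_le (r := r) hP hmono k
      ⟨_, fun z => hc z ∅ (by simp)⟩ }

variable (hP : WithSeminorms P) (hmono : Monotone P) (hτ : SummablyBounded P τ)

theorem SummablyBounded.smallOnTails_sumMap :
    SmallOnTails (hτ.sumMap hP hmono (r := r)).toLinearMap := by
  intro U hU
  obtain ⟨k, ε, hε, hU⟩ := exists_seminorm_ball_subset hP hmono hU
  obtain ⟨c, hτc⟩ := hτ.exists_seminorm_tsum_le (r := r) hP hmono k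
  lift ε to ℝ≥0 using hε.le
  obtain ⟨s, hs⟩ := ((NNReal.tendsto_tsum_compl_atTop_zero c).eventually_lt_const
    (NNReal.coe_pos.1 hε)).exists
  refine ⟨s, fun w hw hws => hU ((P k).mem_ball_zero.2 ?_)⟩
  exact ((hτc w s hws).trans (mul_le_of_le_one_right (NNReal.coe_nonneg _) hw)).trans_lt hs

end SummableSeries

section FiniteNets

open scoped NNReal

variable {𝕜 X : Type*} [RCLike 𝕜] [AddCommGroup X] [Module 𝕜 X]

variable (𝕜) in
/-- Linear combinations of the points of a finite set, as a map from the `ℓ¹`-space over that set: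
its unit ball is mapped onto the absolutely convex hull of the set. -/
noncomputable def finsetCombination (F : Finset X) : PiLp 1 (fun _ : F => 𝕜) →ₗ[𝕜] X :=
  Fintype.linearCombination 𝕜 Subtype.val ∘ₗ (WithLp.linearEquiv 1 𝕜 (F → 𝕜)).toLinearMap

theorem finsetCombination_single {F : Finset X} [DecidableEq F] (f : F) (a : 𝕜) :
    finsetCombination 𝕜 F (PiLp.single 1 f a) = a • (f : X) :=
  Fintype.linearCombination_apply_single 𝕜 Subtype.val f a

theorem seminorm_finsetCombination_le {q : Seminorm 𝕜 X} {F : Finset X} {C : ℝ}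
    (hC : ∀ f ∈ F, q f ≤ C) (y : PiLp 1 (fun _ : F => 𝕜)) :
    q (finsetCombination 𝕜 F y) ≤ C * ‖y‖ :=
  calc q (∑ f : F, y f • (f : X))
      ≤ ∑ f : F, q (y f • (f : X)) := seminorm_sum_le q _ _
    _ ≤ ∑ f : F, C * ‖y f‖ := Finset.sum_le_sum fun f _ => by
        rw [map_smul_eq_mul, mul_comm]
        exact mul_le_mul_of_nonneg_right (hC f f.2) (norm_nonneg _)
    _ = C * ‖y‖ := by rw [← Finset.mul_sum, PiLp.norm_eq_of_L1]

theorem summablyBounded_two_pow_smul_finsetCombination {κ : Type*} {P : SeminormFamily 𝕜 X κ}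
    {F : ℕ → Finset X} {C : ℝ≥0}
    (hF : ∀ j, ∀ᶠ k in atTop, ∀ f ∈ F k, P j f ≤ C * (1 / 4) ^ k) :
    SummablyBounded P fun k => (2 : 𝕜) ^ k • finsetCombination 𝕜 (F k) := by
  intro j
  let q : X → ℝ≥0 := fun x => ⟨P j x, apply_nonneg _ _⟩
  refine ⟨fun k => 2 ^ k * (F k).sup q, ?_, fun k y => ?_⟩
  · have hgeom : Summable fun k : ℕ => C * (1 / 2 : ℝ) ^ k :=
      (summable_geometric_of_lt_one (by norm_num) (by norm_num)).mul_left _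
    refine NNReal.summable_coe.1 (hgeom.of_norm_bounded_eventually_nat ?_)
    filter_upwards [hF j] with k hk
    have hsup : (F k).sup q ≤ C * (1 / 4) ^ k := Finset.sup_le fun f hf => by
      rw [← NNReal.coe_le_coe]
      push_cast
      exact hk f hf
    calc ‖((2 ^ k * (F k).sup q : ℝ≥0) : ℝ)‖ = 2 ^ k * (F k).sup q := by simp
      _ ≤ 2 ^ k * (C * (1 / 4) ^ k) := by gcongr; exact_mod_cast hsup
      _ = C * (1 / 2) ^ k := by
        rw [mul_left_comm, ← mul_pow]
        norm_num
  · have hle (f : X) (hf : f ∈ F k) : P j f ≤ (F k).sup q :=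
      NNReal.coe_le_coe.2 (Finset.le_sup (f := q) hf)
    calc P j ((2 : 𝕜) ^ k • finsetCombination 𝕜 (F k) y)
        = 2 ^ k * P j (finsetCombination 𝕜 (F k) y) := by
          rw [map_smul_eq_mul, norm_pow, RCLike.norm_ofNat]
      _ ≤ 2 ^ k * ((F k).sup q * ‖y‖) := by
          gcongr
          exact seminorm_finsetCombination_le hle y
      _ = (2 ^ k * (F k).sup q : ℝ≥0) * ‖y‖ := by
          push_cast
          ring

theorem tendsto_of_forall_seminorm_sub_lt [TopologicalSpace X] {P : SeminormFamily 𝕜 X ℕ}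
    (hP : WithSeminorms P) (hmono : Monotone P) {g : ℕ → X} {x : X} {ε : ℕ → ℝ}
    (hg : ∀ k, P k (x - g k) < ε k) (hε : Tendsto ε atTop (𝓝 0)) : Tendsto g atTop (𝓝 x) := by
  have := hP.topologicalAddGroup
  refine (hP.tendsto_nhds g x).2 fun j δ hδ => ?_
  filter_upwards [eventually_ge_atTop j, hε.eventually_lt_const hδ] with n hn hnδ
  rw [map_sub_rev]
  exact (hmono hn _).trans_lt ((hg n).trans hnδ)

section Net

variable [UniformSpace X] [IsUniformAddGroup X]

theorem exists_finset_forall_exists_seminorm_sub_lt {q : Seminorm 𝕜 X} (hq : Continuous q)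
    {K : Set X} (hK : TotallyBounded K) {ε : ℝ} (hε : 0 < ε) :
    ∃ G : Finset X, ∀ x ∈ K, ∃ g ∈ G, q (x - g) < ε := by
  have hU : {x : X | q x < ε} ∈ 𝓝 (0 : X) :=
    (hq.tendsto' 0 0 (map_zero q)).eventually_lt_const hε
  obtain ⟨t, ht, hsub⟩ := totallyBounded_iff_subset_finite_iUnion_nhds_zero.1 hK _ hU
  refine ⟨ht.toFinset, fun x hx => ?_⟩
  obtain ⟨g, hg, y, hy, rfl⟩ := Set.mem_iUnion₂.1 (hsub hx)
  exact ⟨g, ht.mem_toFinset.2 hg, by simpa using hy⟩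

variable {P : SeminormFamily 𝕜 X ℕ}

theorem exists_finset_seq_forall_exists_tendsto_sum (hP : WithSeminorms P) (hmono : Monotone P)
    {K : Set X} (hK : TotallyBounded K) : ∃ F : ℕ → Finset X,
      (∀ j, ∀ᶠ k in atTop, ∀ f ∈ F k, P j f ≤ 8 * (1 / 4) ^ k) ∧
      ∀ x ∈ K, ∃ f : ℕ → X, (∀ k, f k ∈ F k) ∧
        Tendsto (fun n => ∑ k ∈ Finset.range n, f k) atTop (𝓝 x) := by
  classical
  have hnet (k : ℕ) := exists_finset_forall_exists_seminorm_sub_lt (hP.continuous_seminorm k) hK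
    (show (0 : ℝ) < (1 / 4) ^ k by positivity)
  choose G hG using hnet
  let F : ℕ → Finset X
    | 0 => G 0
    | k + 1 => (Finset.image₂ (· - ·) (G (k + 1)) (G k)).filter fun f => P k f ≤ 2 * (1 / 4) ^ k
  refine ⟨F, fun j => ?_, fun x hx => ?_⟩
  · filter_upwards [eventually_gt_atTop j] with k hk f hf
    obtain ⟨k, rfl⟩ := Nat.exists_eq_add_of_lt hk
    have hPf := (hmono (Nat.le_add_right j k) f).trans (Finset.mem_filter.1 hf).2
    rw [pow_succ]
    linarith
  choose g hgG hg using fun k => hG k x hx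
  let f : ℕ → X
    | 0 => g 0
    | k + 1 => g (k + 1) - g k
  have hsum (n : ℕ) : ∑ k ∈ Finset.range (n + 1), f k = g n := by
    rw [Finset.sum_range_succ', Finset.sum_range_sub, sub_add_cancel]
  refine ⟨f, fun k => ?_, ?_⟩
  · cases k with
    | zero => exact hgG 0
    | succ k =>
      refine Finset.mem_filter.2 ⟨Finset.mem_image₂_of_mem (hgG _) (hgG _), ?_⟩
      have hgk := (hmono k.le_succ _).trans_lt (hg (k + 1))
      have htri := map_sub_le_add (P k) (x - g k) (x - g (k + 1))
      rw [sub_sub_sub_cancel_left] at htri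
      have := hg k
      rw [pow_succ] at hgk
      linarith [show (0 : ℝ) < (1 / 4) ^ k by positivity]
  · rw [← tendsto_add_atTop_iff_nat 1]
    simp only [hsum]
    exact tendsto_of_forall_seminorm_sub_lt hP hmono hg <|
      tendsto_pow_atTop_nhds_zero_of_lt_one (by norm_num) (by norm_num)

end Net

end FiniteNets

section AbsorbingSubspace

variable {𝕜 X : Type*} [RCLike 𝕜] [AddCommGroup X] [Module 𝕜 X] {P : SeminormFamily 𝕜 X ℕ}

theorem totallyBounded_iUnion_of_eventually_subset [UniformSpace X] [IsUniformAddGroup X]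
    {A : ℕ → Set X} (hA : ∀ j, TotallyBounded (A j))
    (h : ∀ U ∈ 𝓝 (0 : X), ∀ᶠ j in atTop, A j ⊆ U) : TotallyBounded (⋃ j, A j) := by
  rw [totallyBounded_iff_subset_finite_iUnion_nhds_zero]
  intro U hU
  obtain ⟨N, hN⟩ := eventually_atTop.1 (h U hU)
  have hfin : TotallyBounded (⋃ j ∈ Set.Iio N, A j) :=
    (totallyBounded_biUnion (Set.finite_Iio N)).2 fun j _ => hA j
  obtain ⟨t, ht, hsub⟩ := totallyBounded_iff_subset_finite_iUnion_nhds_zero.1 hfin U hU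
  refine ⟨insert 0 t, ht.insert 0, Set.iUnion_subset fun j => ?_⟩
  rw [Set.biUnion_insert]
  rcases lt_or_ge j N with hj | hj
  · have hAj : A j ⊆ ⋃ j ∈ Set.Iio N, A j := Set.subset_biUnion_of_mem (Set.mem_Iio.2 hj)
    exact hAj.trans (hsub.trans Set.subset_union_right)
  · exact fun x hx => Or.inl ⟨x, hN j hj hx, zero_add x⟩

theorem isCompact_preimage_of_forall_exists_smul_eq {F : Type*} [AddCommGroup F] [Module 𝕜 F]
    [TopologicalSpace F] [ContinuousSMul 𝕜 F] [TopologicalSpace X] [T2Space X] {T : F →ₗ[𝕜] X}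
    (hT : Continuous T) (hinj : Function.Injective T) {Q : Set F} (hQ : IsCompact Q)
    {K : Set X} (hK : IsCompact K) {a : X → 𝕜} (ha : ContinuousOn a K)
    (hKQ : ∀ x ∈ K, ∃ e ∈ Q, a x • T e = x) :
    IsCompact (T ⁻¹' K) := by
  have hsmul : IsCompact ((fun c : 𝕜 × F => c.1 • c.2) '' ((a '' K) ×ˢ Q)) :=
    ((hK.image_of_continuousOn ha).prod hQ).image continuous_smul
  refine hsmul.of_isClosed_subset (hK.isClosed.preimage hT) fun e he => ?_
  obtain ⟨q, hq, hqe⟩ := hKQ _ he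
  exact ⟨(a (T e), q), ⟨Set.mem_image_of_mem a he, hq⟩, hinj ((map_smul T _ q).trans hqe)⟩

variable (P) in
/-- Dividing the points of the `j`-th member of a sequence of bounded sets by this weight yields a
sequence of sets that shrinks to zero. -/
def shrinkingWeight (j : ℕ) (x : X) : ℝ := 2 ^ j * (1 + P j x)

theorem one_le_shrinkingWeight (j : ℕ) (x : X) : 1 ≤ shrinkingWeight P j x :=
  one_le_mul_of_one_le_of_one_le (one_le_pow₀ one_le_two)
    (le_add_of_nonneg_right (apply_nonneg _ _))

theorem shrinkingWeight_pos (j : ℕ) (x : X) : 0 < shrinkingWeight P j x :=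
  one_pos.trans_le (one_le_shrinkingWeight j x)

theorem continuous_ofReal_shrinkingWeight [TopologicalSpace X] (hP : WithSeminorms P)
    (j : ℕ) : Continuous fun x => (shrinkingWeight P j x : 𝕜) :=
  RCLike.continuous_ofReal.comp
    (continuous_const.mul (continuous_const.add (hP.continuous_seminorm j)))

theorem seminorm_shrinkingWeight_inv_smul_le (hmono : Monotone P) {k j : ℕ} (hkj : k ≤ j) (x : X) :
    P k ((shrinkingWeight P j x : 𝕜)⁻¹ • x) ≤ (1 / 2) ^ j := by
  have hpos := shrinkingWeight_pos (P := P) j x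
  rw [map_smul_eq_mul, norm_inv, RCLike.norm_ofReal, abs_of_pos hpos, inv_mul_le_iff₀ hpos,
    shrinkingWeight, mul_right_comm, ← mul_pow, mul_one_div_cancel two_ne_zero, one_pow, one_mul]
  exact (hmono hkj x).trans (le_add_of_nonneg_left zero_le_one)

theorem totallyBounded_iUnion_shrinkingWeight_inv_smul [UniformSpace X] [IsUniformAddGroup X]
    (hP : WithSeminorms P) (hmono : Monotone P) {K : ℕ → Set X} (hK : ∀ j, IsCompact (K j)) :
    TotallyBounded (⋃ j, (fun x => (shrinkingWeight P j x : 𝕜)⁻¹ • x) '' K j) := by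
  have := hP.continuousSMul
  refine totallyBounded_iUnion_of_eventually_subset (fun j => ?_) fun U hU => ?_
  · have hcont : Continuous fun x => (shrinkingWeight P j x : 𝕜)⁻¹ • x :=
      ((continuous_ofReal_shrinkingWeight hP j).inv₀ fun x =>
        RCLike.ofReal_ne_zero.2 (shrinkingWeight_pos j x).ne').smul continuous_id
    exact ((hK j).image hcont).totallyBounded
  obtain ⟨k, r, hr, hU⟩ := exists_seminorm_ball_subset hP hmono hU
  have hlim : Tendsto (fun j : ℕ => (1 / 2 : ℝ) ^ j) atTop (𝓝 0) :=
    tendsto_pow_atTop_nhds_zero_of_lt_one (by norm_num) (by norm_num)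
  filter_upwards [eventually_ge_atTop k, hlim.eventually_lt_const hr] with j hkj hj
  rintro _ ⟨x, -, rfl⟩
  exact hU ((P k).mem_ball_zero.2 ((seminorm_shrinkingWeight_inv_smul_le hmono hkj x).trans_lt hj))

variable [UniformSpace X] [IsUniformAddGroup X] [T2Space X] [CompleteSpace X]

theorem exists_sumMap_finsetCombination_eq (hP : WithSeminorms P) (hmono : Monotone P)
    {F : ℕ → Finset X} (hτ : SummablyBounded P fun k => (2 : 𝕜) ^ k • finsetCombination 𝕜 (F k))
    {f : ℕ → X} (hf : ∀ k, f k ∈ F k) {x : X}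
    (hfx : Tendsto (fun n => ∑ k ∈ Finset.range n, f k) atTop (𝓝 x)) :
    ∃ z : lp (fun k => PiLp 1 fun _ : F k => 𝕜) 2,
      (∀ k, ‖z k‖ ≤ (1 / 2) ^ k) ∧ hτ.sumMap hP hmono z = x := by
  classical
  let z₀ (k : ℕ) : PiLp 1 fun _ : F k => 𝕜 := PiLp.single 1 ⟨f k, hf k⟩ ((1 / 2 : 𝕜) ^ k)
  have hz₀ (k : ℕ) : ‖z₀ k‖ ≤ (1 / 2) ^ k := by
    rw [PiLp.norm_single, norm_pow, norm_div, norm_one, RCLike.norm_ofNat]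
  have hτz₀ (k : ℕ) : ((2 : 𝕜) ^ k • finsetCombination 𝕜 (F k)) (z₀ k) = f k := by
    rw [LinearMap.smul_apply, finsetCombination_single, smul_smul, ← mul_pow,
      mul_one_div_cancel two_ne_zero, one_pow, one_smul]
  have hgeom : Summable fun k : ℕ => (1 / 2 : ℝ) ^ k :=
    summable_geometric_of_lt_one (by norm_num) (by norm_num)
  let z : lp (fun k => PiLp 1 fun _ : F k => 𝕜) 2 :=
    ⟨z₀, memℓp_of_summable_of_norm_le hgeom hz₀⟩
  have hsummable : Summable f := summable_of_summable_seminorm hP hmono fun j =>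
    (hτ.summable_seminorm z j).congr fun k => congrArg (P j) (hτz₀ k)
  refine ⟨z, hz₀, ?_⟩
  calc hτ.sumMap hP hmono z = ∑' k, f k := tsum_congr hτz₀
    _ = x := tendsto_nhds_unique hsummable.hasSum.tendsto_sum_nat hfx

theorem exists_isSeparableReflexiveCompact_of_totallyBounded (hP : WithSeminorms P)
    (hmono : Monotone P) {K : Set X} (hK : TotallyBounded K) :
    ∃ E : NormedSubspace 𝕜 X, E.IsSeparableReflexiveCompact ∧ Continuous E.incl ∧
      ∃ Q : Set E.Space, IsCompact Q ∧ K ⊆ E.incl '' Q := by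
  obtain ⟨F, hF, hKF⟩ := exists_finset_seq_forall_exists_tendsto_sum hP hmono hK
  have hproper (k : ℕ) : ProperSpace (PiLp 1 fun _ : F k => 𝕜) :=
    FiniteDimensional.proper_rclike 𝕜 _
  have hτ : SummablyBounded P fun k => (2 : 𝕜) ^ k • finsetCombination 𝕜 (F k) :=
    summablyBounded_two_pow_smul_finsetCombination (C := 8) hF
  let T : lp (fun k => PiLp 1 fun _ : F k => 𝕜) 2 →L[𝕜] X := hτ.sumMap hP hmono
  have hQ : IsCompact {z : lp (fun k => PiLp 1 fun _ : F k => 𝕜) 2 | ∀ k, ‖z k‖ ≤ (1 / 2) ^ k} :=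
    isCompact_setOf_norm_apply_le (by simp)
      (summable_geometric_of_lt_one (by norm_num) (by norm_num))
  refine ⟨_, (hτ.smallOnTails_sumMap hP hmono).isSeparableReflexiveCompact_range,
    NormedSubspace.continuous_incl_range _ _ T.continuous, _,
    hQ.image (NormedSubspace.toRange T.toLinearMap T.isClosed_ker).continuous, fun x hx => ?_⟩
  obtain ⟨f, hf, hfx⟩ := hKF x hx
  obtain ⟨z, hz, hzx⟩ := exists_sumMap_finsetCombination_eq hP hmono hτ hf hfx
  exact ⟨_, Set.mem_image_of_mem _ hz, (NormedSubspace.incl_toRange _ _ z).trans hzx⟩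

theorem exists_isSeparableReflexiveCompact_of_compacts (hP : WithSeminorms P) (hmono : Monotone P)
    {K : ℕ → Set X} (hK : ∀ j, IsCompact (K j)) :
    ∃ E : NormedSubspace 𝕜 X, E.IsSeparableReflexiveCompact ∧ Continuous E.incl ∧
      (∀ j, K j ⊆ E.carrier ∧ IsCompact (E.incl ⁻¹' K j)) ∧
      ∃ R : ℝ, ∀ j e, E.incl e ∈ K j → ‖e‖ ≤ R * shrinkingWeight P j (E.incl e) := by
  obtain ⟨E, hE, hcont, Q, hQ, hKQ⟩ := exists_isSeparableReflexiveCompact_of_totallyBounded hP hmono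
    (totallyBounded_iUnion_shrinkingWeight_inv_smul hP hmono hK)
  have hsmul (j : ℕ) (x : X) (hx : x ∈ K j) :
      ∃ e ∈ Q, (shrinkingWeight P j x : 𝕜) • E.incl e = x := by
    obtain ⟨e, he, hex⟩ := hKQ (Set.mem_iUnion.2 ⟨j, x, hx, rfl⟩)
    refine ⟨e, he, ?_⟩
    rw [hex, smul_inv_smul₀ (RCLike.ofReal_ne_zero.2 (shrinkingWeight_pos j x).ne')]
  obtain ⟨R, hR⟩ := hQ.isBounded.exists_norm_le
  refine ⟨E, hE, hcont, fun j => ⟨fun x hx => ?_, ?_⟩, R, fun j e he => ?_⟩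
  · obtain ⟨e, -, hex⟩ := hsmul j x hx
    rw [← E.range_incl]
    exact ⟨_, (map_smul E.incl _ e).trans hex⟩
  · exact isCompact_preimage_of_forall_exists_smul_eq hcont E.incl_injective hQ (hK j)
      (continuous_ofReal_shrinkingWeight hP j).continuousOn (hsmul j)
  · obtain ⟨q, hq, hqe⟩ := hsmul j _ he
    rw [← map_smul] at hqe
    calc ‖e‖ = shrinkingWeight P j (E.incl e) * ‖q‖ := by
          rw [← E.incl_injective hqe, norm_smul, RCLike.norm_ofReal, E.incl_injective hqe,
            abs_of_pos (shrinkingWeight_pos _ _)]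
      _ ≤ R * shrinkingWeight P j (E.incl e) := by
          rw [mul_comm]
          exact mul_le_mul_of_nonneg_right (hR q hq) (shrinkingWeight_pos _ _).le

end AbsorbingSubspace

section Restriction

variable {X Y : Type*} [MeasurableSpace X] [MeasurableSpace Y] {f : Y → X}

theorem mutuallySingular_comap (hf : MeasurableEmbedding f) {μ ν : Measure X}
    (h : μ.MutuallySingular ν) : (μ.comap f).MutuallySingular (ν.comap f) := by
  obtain ⟨s, hs, hμ, hν⟩ := h
  refine ⟨f ⁻¹' s, hf.measurable hs, ?_, ?_⟩
  · rw [hf.comap_apply]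
    exact measure_mono_null (Set.image_preimage_subset f s) hμ
  · rw [hf.comap_apply, ← Set.preimage_compl]
    exact measure_mono_null (Set.image_preimage_subset f sᶜ) hν

theorem totalVariation_restrictAlong (hf : MeasurableEmbedding f) (μ : SignedMeasure X) :
    (restrictAlong hf μ).totalVariation = μ.totalVariation.comap f := by
  let j : JordanDecomposition Y :=
    { posPart := μ.toJordanDecomposition.posPart.comap f
      negPart := μ.toJordanDecomposition.negPart.comap f
      mutuallySingular := mutuallySingular_comap hf μ.toJordanDecomposition.mutuallySingular }
  have hj : restrictAlong hf μ = j.toSignedMeasure := by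
    ext i hi
    rw [JordanDecomposition.toSignedMeasure, Measure.toSignedMeasure_sub_apply hi]
    change μ (f '' i) = _
    rw [μ.apply_eq_posPart_real_sub_negPart_real (hf.measurableSet_image.2 hi)]
    simp only [Measure.real, j, hf.comap_apply]
  rw [SignedMeasure.totalVariation, SignedMeasure.toJordanDecomposition_eq hj,
    SignedMeasure.totalVariation, hf.comap_add]

theorem setLIntegral_comap_le (hf : MeasurableEmbedding f) (μ : Measure X) (s : Set X)
    (g : X → ENNReal) : ∫⁻ y in f ⁻¹' s, g (f y) ∂(μ.comap f) ≤ ∫⁻ x in s, g x ∂μ := by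
  rw [← hf.lintegral_map, ← hf.restrict_map, hf.map_comap]
  exact lintegral_mono' (Measure.restrict_mono le_rfl Measure.restrict_le_self) le_rfl

theorem isRadonSigned_of_polishSpace [TopologicalSpace X] [PolishSpace X] [BorelSpace X]
    (μ : SignedMeasure X) : IsRadonSigned μ := by
  intro B hB ε hε
  obtain ⟨K, hKB, hK, hBK⟩ :=
    hB.exists_isCompact_sdiff_lt (measure_ne_top μ.totalVariation B) hε.ne'
  exact ⟨K, hK, hKB, hBK⟩

end Restriction

section SmallOutsideCompacts

open scoped ENNReal

variable {X : Type*} [MeasurableSpace X] [TopologicalSpace X] {M : Set (SignedMeasure X)}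

/-- The integrals of `w` with respect to the variations of the measures in `M` are uniformly small
outside compact sets. For `w = 1` this is uniform tightness of `M`; for continuous `w` it implies
uniform integrability. -/
def SmallOutsideCompacts (M : Set (SignedMeasure X)) (w : X → ℝ≥0∞) : Prop :=
  ∀ ε : ℝ≥0∞, 0 < ε → ∃ K : Set X, IsCompact K ∧ ∀ μ ∈ M, ∫⁻ x in Kᶜ, w x ∂μ.totalVariation ≤ ε

namespace SmallOutsideCompacts

variable {v w : X → ℝ≥0∞}

theorem mono (hw : SmallOutsideCompacts M w) (hvw : ∀ x, v x ≤ w x) : SmallOutsideCompacts M v :=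
  fun ε hε =>
    have ⟨K, hK, hint⟩ := hw ε hε
    ⟨K, hK, fun μ hμ => (lintegral_mono hvw).trans (hint μ hμ)⟩

theorem add (hv : SmallOutsideCompacts M v) (hw : SmallOutsideCompacts M w) (hvm : Measurable v) :
    SmallOutsideCompacts M fun x => v x + w x := fun ε hε => by
  obtain ⟨K, hK, hvint⟩ := hv (ε / 2) (ENNReal.half_pos hε.ne')
  obtain ⟨L, hL, hwint⟩ := hw (ε / 2) (ENNReal.half_pos hε.ne')
  refine ⟨K ∪ L, hK.union hL, fun μ hμ => ?_⟩
  rw [lintegral_add_left hvm, ← ENNReal.add_halves ε]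
  gcongr
  · exact (lintegral_mono_set (Set.compl_subset_compl.2 Set.subset_union_left)).trans (hvint μ hμ)
  · exact (lintegral_mono_set (Set.compl_subset_compl.2 Set.subset_union_right)).trans (hwint μ hμ)

theorem const_mul (hw : SmallOutsideCompacts M w) {c : ℝ≥0∞} (hc : c ≠ ∞) :
    SmallOutsideCompacts M fun x => c * w x := fun ε hε => by
  obtain ⟨K, hK, hint⟩ := hw (ε / c) (ENNReal.div_pos hε.ne' hc)
  refine ⟨K, hK, fun μ hμ => ?_⟩
  rw [lintegral_const_mul' _ _ hc]
  exact (mul_le_mul_right (hint μ hμ) c).trans ENNReal.mul_div_le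

theorem finsetSum {ι : Type*} {w : ι → X → ℝ≥0∞} {s : Finset ι}
    (hw : ∀ i ∈ s, SmallOutsideCompacts M (w i)) (hwm : ∀ i ∈ s, Measurable (w i)) :
    SmallOutsideCompacts M fun x => ∑ i ∈ s, w i x := by
  classical
  induction s using Finset.induction_on with
  | empty => exact fun ε _ => ⟨∅, isCompact_empty, by simp⟩
  | insert i s hi ih =>
    simp only [Finset.forall_mem_insert] at hw hwm
    simp only [Finset.sum_insert hi]
    exact hw.1.add (ih hw.2 hwm.2) hwm.1

theorem uniformlyTight (hw : SmallOutsideCompacts M w) (hone : ∀ x, 1 ≤ w x) :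
    UniformlyTight M := fun ε hε => by
  obtain ⟨δ, hδ, hδε⟩ := exists_between hε
  obtain ⟨K, hK, hint⟩ := hw.mono hone δ hδ
  exact ⟨K, hK, fun μ hμ => by simpa only [setLIntegral_one] using (hint μ hμ).trans_lt hδε⟩

theorem uniformlyIntegrableOver {q : X → ℝ} (hcont : Continuous q)
    (hq : SmallOutsideCompacts M fun x => ENNReal.ofReal (q x)) :
    UniformlyIntegrableOver M q := by
  refine ENNReal.tendsto_nhds_zero.2 fun ε hε => ?_
  obtain ⟨K, hK, hint⟩ := hq ε hε
  obtain ⟨m₀, hm₀⟩ := hK.bddAbove_image hcont.continuousOn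
  filter_upwards [eventually_ge_atTop m₀] with m hm
  refine iSup₂_le fun μ hμ => (lintegral_mono_set fun x hx hxK => ?_).trans (hint μ hμ)
  exact ((hm₀ (Set.mem_image_of_mem q hxK)).trans hm).not_gt hx

theorem exists_monotone_compacts {w : ℕ → X → ℝ≥0∞} (hw : ∀ j, SmallOutsideCompacts M (w j))
    {ε : ℕ → ℝ≥0∞} (hε : ∀ j, 0 < ε j) : ∃ K : ℕ → Set X, Monotone K ∧ (∀ j, IsCompact (K j)) ∧
      ∀ j, ∀ μ ∈ M, ∫⁻ x in (K j)ᶜ, w j x ∂μ.totalVariation ≤ ε j := by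
  choose K hK hint using fun j => hw j (ε j) (hε j)
  refine ⟨Set.accumulate K, Set.monotone_accumulate, fun j => ?_, fun j μ hμ => ?_⟩
  · exact (Set.finite_le_nat j).isCompact_biUnion fun i _ => hK i
  · exact (lintegral_mono_set (Set.compl_subset_compl.2 Set.subset_accumulate)).trans (hint j μ hμ)

end SmallOutsideCompacts

theorem UniformlyTight.smallOutsideCompacts_one (hM : UniformlyTight M) :
    SmallOutsideCompacts M fun _ => 1 := fun ε hε =>
  have ⟨K, hK, hKε⟩ := hM ε hε
  ⟨K, hK, fun μ hμ => setLIntegral_one Kᶜ |>.trans_le (hKε μ hμ).le⟩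

theorem UniformlyIntegrableOver.smallOutsideCompacts {q : X → ℝ}
    (hint : UniformlyIntegrableOver M q) (hM : UniformlyTight M) (hq : Measurable q) :
    SmallOutsideCompacts M fun x => ENNReal.ofReal (q x) := by
  intro ε hε
  have hε2 : 0 < ε / 2 := ENNReal.half_pos hε.ne'
  obtain ⟨m, hm⟩ := (ENNReal.tendsto_nhds_zero.1 hint (ε / 2) hε2).exists
  obtain ⟨K, hK, hKε⟩ := hM (ε / 2 / ENNReal.ofReal m)
    (ENNReal.div_pos hε2.ne' ENNReal.ofReal_ne_top)
  refine ⟨K, hK, fun μ hμ => ?_⟩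
  have hs : MeasurableSet {x | m < q x} := measurableSet_lt measurable_const hq
  rw [← lintegral_inter_add_sdiff _ _ hs, ← ENNReal.add_halves ε]
  gcongr
  · calc ∫⁻ x in Kᶜ ∩ {x | m < q x}, ENNReal.ofReal (q x) ∂μ.totalVariation
        ≤ ∫⁻ x in {x | m < q x}, ENNReal.ofReal (q x) ∂μ.totalVariation :=
          lintegral_mono_set Set.inter_subset_right
      _ ≤ ε / 2 := (iSup₂_le_iff.1 hm) μ hμ
  · calc ∫⁻ x in Kᶜ \ {x | m < q x}, ENNReal.ofReal (q x) ∂μ.totalVariation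
        ≤ ∫⁻ _ in Kᶜ \ {x | m < q x}, ENNReal.ofReal m ∂μ.totalVariation :=
          setLIntegral_mono measurable_const fun x hx =>
            ENNReal.ofReal_le_ofReal (not_lt.1 hx.2)
      _ ≤ ENNReal.ofReal m * μ.totalVariation Kᶜ := by
          rw [setLIntegral_const]
          gcongr
          exact Set.sdiff_subset
      _ ≤ ENNReal.ofReal m * (ε / 2 / ENNReal.ofReal m) := by
          gcongr
          exact (hKε μ hμ).le
      _ ≤ ε / 2 := ENNReal.mul_div_le

end SmallOutsideCompacts

section Exhaustion

open scoped ENNReal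

variable {X Y : Type*} [MeasurableSpace X] [MeasurableSpace Y]

theorem exists_mem_succ_diff_of_mem_iUnion {α : Type*} {L : ℕ → Set α} (hL : Monotone L) {N : ℕ}
    {y : α} (hy : y ∈ ⋃ j, L j) (hyN : y ∉ L N) : ∃ i, y ∈ L (N + i + 1) \ L (N + i) := by
  classical
  obtain ⟨j, hj⟩ := Set.mem_iUnion.1 hy
  have hex : ∃ i, y ∈ L (N + i) := ⟨j, hL (Nat.le_add_left j N) hj⟩
  obtain ⟨i, hi⟩ := Nat.exists_eq_succ_of_ne_zero fun h0 : Nat.find hex = 0 =>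
    hyN (by simpa only [h0, add_zero] using Nat.find_spec hex)
  have hmem := Nat.find_spec hex
  rw [hi] at hmem
  exact ⟨i, hmem, Nat.find_min hex (hi ▸ i.lt_succ_self)⟩

theorem setLIntegral_compl_le_tsum {ν : Measure Y} {L : ℕ → Set Y} (hmono : Monotone L)
    (hL : ∀ j, MeasurableSet (L j)) (hν : ν (⋃ j, L j)ᶜ = 0) {h : Y → ℝ≥0∞} {g : ℕ → Y → ℝ≥0∞}
    (hg : ∀ j, ∀ y ∈ L (j + 1), h y ≤ g j y) (N : ℕ) :
    ∫⁻ y in (L N)ᶜ, h y ∂ν ≤ ∑' i, ∫⁻ y in (L (N + i))ᶜ, g (N + i) y ∂ν := by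
  have hcover : (L N)ᶜ ≤ᵐ[ν] ⋃ i, L (N + i + 1) \ L (N + i) := by
    filter_upwards [mem_ae_iff.2 hν] with y hy hyN
    exact Set.mem_iUnion.2 (exists_mem_succ_diff_of_mem_iUnion hmono hy hyN)
  calc ∫⁻ y in (L N)ᶜ, h y ∂ν
      ≤ ∫⁻ y in ⋃ i, L (N + i + 1) \ L (N + i), h y ∂ν := lintegral_mono_set' hcover
    _ ≤ ∑' i, ∫⁻ y in L (N + i + 1) \ L (N + i), h y ∂ν := lintegral_iUnion_le _ _
    _ ≤ ∑' i, ∫⁻ y in (L (N + i))ᶜ, g (N + i) y ∂ν := ENNReal.tsum_le_tsum fun i =>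
        (setLIntegral_mono' ((hL _).diff (hL _)) fun y hy => hg _ y hy.1).trans
          (lintegral_mono_set fun _ hy => hy.2)

theorem measure_compl_iUnion_eq_zero {μ : Measure X} {K : ℕ → Set X} {w : ℕ → X → ℝ≥0∞}
    (hw : ∀ j x, 1 ≤ w j x) {δ : ℕ → ℝ≥0∞} (hδ : Tendsto δ atTop (𝓝 0))
    (hK : ∀ j, ∫⁻ x in (K j)ᶜ, w j x ∂μ ≤ δ j) : μ (⋃ j, K j)ᶜ = 0 :=
  le_bot_iff.1 <| ge_of_tendsto' hδ fun j =>
    calc μ (⋃ j, K j)ᶜ ≤ μ (K j)ᶜ :=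
          measure_mono (Set.compl_subset_compl.2 (Set.subset_iUnion K j))
      _ = ∫⁻ _ in (K j)ᶜ, 1 ∂μ := (setLIntegral_one _).symm
      _ ≤ δ j := (lintegral_mono (hw j)).trans (hK j)

theorem SmallOutsideCompacts.restrictAlong_of_exhaustion [TopologicalSpace Y]
    {M : Set (SignedMeasure X)} {f : Y → X} (hf : MeasurableEmbedding f) {K : ℕ → Set X}
    (hmono : Monotone K) (hK : ∀ j, MeasurableSet (K j)) (hKf : ∀ j, IsCompact (f ⁻¹' K j))
    (hnull : ∀ μ ∈ M, μ.totalVariation (⋃ j, K j)ᶜ = 0) {w : ℕ → X → ℝ≥0∞} {δ : ℕ → ℝ≥0∞}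
    (hδ : ∑' j, δ j ≠ ∞) (hw : ∀ j, ∀ μ ∈ M, ∫⁻ x in (K j)ᶜ, w j x ∂μ.totalVariation ≤ δ j)
    {h : Y → ℝ≥0∞} {C : ℝ≥0∞} (hC : C ≠ ∞)
    (hle : ∀ j y, f y ∈ K (j + 1) → h y ≤ C * w j (f y)) :
    SmallOutsideCompacts (restrictAlong hf '' M) h := by
  intro ε hε
  have hlim : Tendsto (fun N => ∑' i, C * δ (i + N)) atTop (𝓝 0) :=
    ENNReal.tendsto_sum_nat_add (fun i => C * δ i) <| by
      rw [ENNReal.tsum_mul_left]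
      exact ENNReal.mul_ne_top hC hδ
  obtain ⟨N, hN⟩ := (hlim.eventually_le_const hε).exists
  refine ⟨f ⁻¹' K N, hKf N, ?_⟩
  rintro _ ⟨μ, hμ, rfl⟩
  rw [totalVariation_restrictAlong]
  have hnull' : μ.totalVariation.comap f (⋃ j, f ⁻¹' K j)ᶜ = 0 := by
    rw [hf.comap_apply, ← Set.preimage_iUnion, ← Set.preimage_compl]
    exact measure_mono_null (Set.image_preimage_subset _ _) (hnull μ hμ)
  have hterm (j : ℕ) : ∫⁻ y in (f ⁻¹' K j)ᶜ, C * w j (f y) ∂μ.totalVariation.comap f ≤ C * δ j := by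
    rw [lintegral_const_mul' _ _ hC]
    gcongr
    exact (setLIntegral_comap_le hf _ _ _).trans (hw j μ hμ)
  calc ∫⁻ y in (f ⁻¹' K N)ᶜ, h y ∂μ.totalVariation.comap f
      ≤ ∑' i, ∫⁻ y in (f ⁻¹' K (N + i))ᶜ, C * w (N + i) (f y) ∂μ.totalVariation.comap f :=
        setLIntegral_compl_le_tsum (fun _ _ hij => Set.preimage_mono (hmono hij))
          (fun j => hf.measurable (hK j)) hnull' hle N
    _ ≤ ∑' i, C * δ (N + i) := ENNReal.tsum_le_tsum fun i => hterm (N + i)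
    _ ≤ ε := by simpa only [add_comm N] using hN

end Exhaustion

section WeightIntegrals

variable {𝕜 : Type*} [RCLike 𝕜] {X : Type*} [AddCommGroup X] [Module 𝕜 X] [TopologicalSpace X]
  [MeasurableSpace X] {M : Set (SignedMeasure X)} {p : SeminormFamily 𝕜 X ℕ}

theorem smallOutsideCompacts_finset_sup [BorelSpace X] (hp : WithSeminorms p)
    (htight : UniformlyTight M) (hint : ∀ n, UniformlyIntegrableOver M (p n)) (s : Finset ℕ) :
    SmallOutsideCompacts M fun x => ENNReal.ofReal (s.sup p x) := by
  have hm (n : ℕ) : Measurable (p n) := (hp.continuous_seminorm n).measurable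
  have hsum : SmallOutsideCompacts M fun x => ∑ n ∈ s, ENNReal.ofReal (p n x) :=
    .finsetSum (fun n _ => (hint n).smallOutsideCompacts htight (hm n))
      fun n _ => (hm n).ennreal_ofReal
  refine hsum.mono fun x => ?_
  rw [← ENNReal.ofReal_sum_of_nonneg fun n _ => apply_nonneg _ _]
  exact ENNReal.ofReal_le_ofReal (by simpa using Seminorm.finset_sup_le_sum p s x)

theorem smallOutsideCompacts_shrinkingWeight (htight : UniformlyTight M) {j : ℕ}
    (hp : SmallOutsideCompacts M fun x => ENNReal.ofReal (p j x)) :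
    SmallOutsideCompacts M fun x => ENNReal.ofReal (shrinkingWeight p j x) := by
  have hofReal (x : X) : ENNReal.ofReal (shrinkingWeight p j x) =
      2 ^ j * (1 + ENNReal.ofReal (p j x)) := by
    rw [shrinkingWeight, ENNReal.ofReal_mul (by positivity), ENNReal.ofReal_pow zero_le_two,
      ENNReal.ofReal_add zero_le_one (apply_nonneg _ _), ENNReal.ofReal_one, ENNReal.ofReal_ofNat]
  simp only [hofReal]
  exact (htight.smallOutsideCompacts_one.add hp measurable_const).const_mul (by finiteness)

theorem one_add_ofReal_le_mul_ofReal {a b R : ℝ} (hb : 1 ≤ b) (hab : a ≤ R * b) :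
    1 + ENNReal.ofReal a ≤ (1 + ENNReal.ofReal R) * ENNReal.ofReal b := by
  rw [add_mul, one_mul, ← ENNReal.ofReal_mul' (zero_le_one.trans hb)]
  gcongr
  exact ENNReal.one_le_ofReal.2 hb

end WeightIntegrals

theorem theorem2p6 {𝕜 : Type*} [RCLike 𝕜]
    -- a Fréchet space, with a sequence of seminorms generating its topology
    {X : Type*} [AddCommGroup X] [Module 𝕜 X] [UniformSpace X] [IsUniformAddGroup X]
    [T2Space X] [CompleteSpace X] (p : SeminormFamily 𝕜 X ℕ) (hp : WithSeminorms p)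
    [MeasurableSpace X] [BorelSpace X]
    (M : Set (SignedMeasure X)) (hradon : ∀ μ ∈ M, IsRadonSigned μ)
    (htight : UniformlyTight M) (hint : ∀ n, UniformlyIntegrableOver M (p n)) :
    ∃ E : NormedSubspace 𝕜 X,
      -- (i) `E` is a separable reflexive Banach space whose closed unit ball is compact in `X`
      (CompleteSpace E.Space ∧ TopologicalSpace.SeparableSpace E.Space ∧
        IsReflexiveSpace 𝕜 E.Space ∧ IsCompact (E.incl '' Metric.closedBall 0 1)) ∧
      -- (ii) Borel sets of `E` are Borel in `X`, `M` is concentrated on `E`, its restriction to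
      -- `E` is a uniformly tight family of Radon measures and the norm is uniformly integrable
      ∃ hE : MeasurableEmbedding E.incl,
        (∀ μ ∈ M, μ.totalVariation (E.carrier : Set X)ᶜ = 0) ∧
        (∀ μ ∈ M, IsRadonSigned (restrictAlong hE μ)) ∧
        UniformlyTight (restrictAlong hE '' M) ∧
        UniformlyIntegrableOver (restrictAlong hE '' M) (fun x : E.Space => ‖x‖) := by
  let P : SeminormFamily 𝕜 X ℕ := fun j => (Finset.Iic j).sup p
  have hP : WithSeminorms P := hp.partial_sups
  have hmono : Monotone P := fun _ _ hij => Finset.sup_mono (Finset.Iic_subset_Iic.2 hij)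
  have hw (j : ℕ) := smallOutsideCompacts_shrinkingWeight (p := P) htight
    (smallOutsideCompacts_finset_sup hp htight hint (Finset.Iic (j + 1)))
  obtain ⟨δ, hδpos, hδ⟩ := ENNReal.exists_pos_sum_of_countable' one_ne_zero ℕ
  obtain ⟨K, hKmono, hK, hKint⟩ := SmallOutsideCompacts.exists_monotone_compacts hw hδpos
  have hnull (μ) (hμ : μ ∈ M) : μ.totalVariation (⋃ j, K j)ᶜ = 0 :=
    measure_compl_iUnion_eq_zero (fun _ x => ENNReal.one_le_ofReal.2 (one_le_shrinkingWeight _ x))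
      (ENNReal.tendsto_atTop_zero_of_tsum_ne_top hδ.ne_top) fun j => hKint j μ hμ
  obtain ⟨E, hE, hcont, hKE, R, hR⟩ := exists_isSeparableReflexiveCompact_of_compacts hP hmono hK
  obtain ⟨_, _, -⟩ := id hE
  have := UniformSpace.secondCountable_of_separable E.Space
  have hEm : MeasurableEmbedding E.incl := hcont.measurableEmbedding E.incl_injective
  have hsmall : SmallOutsideCompacts (restrictAlong hEm '' M) fun e => 1 + ENNReal.ofReal ‖e‖ :=
    .restrictAlong_of_exhaustion hEm hKmono (fun j => (hK j).measurableSet) (fun j => (hKE j).2)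
      hnull hδ.ne_top hKint (C := 1 + ENNReal.ofReal R) (by finiteness) fun j e he =>
        one_add_ofReal_le_mul_ofReal (one_le_shrinkingWeight _ _) (hR (j + 1) e he)
  refine ⟨E, hE, hEm, fun μ hμ => ?_, fun _ _ => isRadonSigned_of_polishSpace _,
    hsmall.uniformlyTight fun _ => le_self_add,
    SmallOutsideCompacts.uniformlyIntegrableOver continuous_norm (hsmall.mono fun _ => le_add_self)⟩
  exact measure_mono_null
    (Set.compl_subset_compl.2 (Set.iUnion_subset fun j => (hKE j).1)) (hnull μ hμ)
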